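/- Let $\mathfrak F$ be a nonempty closed subset of $\mathbb C$ with $\mathfrak F\neq\mathbb C$. Let $\mathcal M(\mathbb C\setminus\mathfrak F)$ be the set of all complex Radon measures $\mu$ on $\mathbb C\setminus\mathfrak F$ (not necessarily of finite total variation) such that $$\|\mu\|_{\mathcal M(\mathbb C\setminus\mathfrak F)}:=\sup_{z\in\mathfrak F}\int_{\mathbb C\setminus\mathfrak F}\frac{d|\mu|(\zeta)}{|\zeta-z|^2}<\infty .$$ Fix $z_0\in\mathfrak F$. For $\mu\in\mathcal M(\mathbb C\setminus\mathfrak F)$ the modified Cauchy integral of $\mu$ is $$\hat\mu_{z_0}(z):=\int_{\mathbb C\setminus\mathfrak F}\Big(\frac1{\zeta-z}-\frac1{\zeta-z_0}\Big)\,d\mu(\zeta),\qquad z\in\mathfrak F .$$ Let $\widehat{\mathcal M}(\mathfrak F)$ be the set of all functions $f$ on $\mathfrak F$ of the form $f=c+\hat\mu_{z_0}$ with $c\in\mathbb C$ a constant and $\mu\in\mathcal M(\mathbb C\setminus\mathfrak F)$, and let $$\|f\|_{\widehat{\mathcal M}(\mathfrak F)}:=\inf\{\|\mu\|_{\mathcal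 M(\mathbb C\setminus\mathfrak F)}:\ \mu\in\mathcal M(\mathbb C\setminus\mathfrak F),\ f-\hat\mu_{z_0}\text{ is constant on }\mathfrak F\}.$$ Let $\mathrm{CL}(\mathfrak F)$ be the set of commutator Lipschitz functions on $\mathfrak F$, that is, of the continuous functions $f:\mathfrak F\to\mathbb C$ for which there is a $C\ge 0$ with $$\|f(N)R-Rf(N)\|\le C\,\|NR-RN\|$$ for every bounded operator $R$ and every bounded normal operator $N$ with spectrum in $\mathfrak F$ on a complex Hilbert space; let $\|f\|_{\mathrm{CL}(\mathfrak F)}$ be the least such $C$. Then $\widehat{\mathcal M}(\mathfrak F)\subset\mathrm{CL}(\mathfrak F)$, and $\|f\|_{\mathrm{CL}(\mathfrak F)}\le\|f\|_{\widehat{\mathcal M}(\mathfrak F)}$ for all $f\in\widehat{\mathcal M}(\mathfrak F)$. -/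

import Mathlib

open MeasureTheory Filter Topology
open scoped ENNReal NNReal

universe u

noncomputable section

namespace CauchyCL

section Radon

variable {X : Type*} [TopologicalSpace X] [MeasurableSpace X]

/-- A complex Radon measure on `X`, as a set function: a complex number `μ s` for every relatively
compact Borel set `s`, countably additive inside every compact set. The total variation need not be
finite. It is used for open subsets `X` of the plane; in such spaces (locally compact, second
countable, Hausdorff) the usual regularity of Radon measures is automatic.
The values outside the relatively compact Borel sets carry no information and are set to `0`. -/
structure ComplexRadonMeasure (X : Type*) [TopologicalSpace X] [MeasurableSpace X] where
  toFun : Set X → ℂ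
  apply_eq_zero : ∀ s, ¬ (MeasurableSet s ∧ ∃ K, IsCompact K ∧ s ⊆ K) → toFun s = 0
  hasSum_iUnion : ∀ K, IsCompact K → ∀ s : ℕ → Set X, (∀ i, MeasurableSet (s i)) →
    (∀ i, s i ⊆ K) → Pairwise (fun i j => Disjoint (s i) (s j)) →
      HasSum (fun i => toFun (s i)) (toFun (⋃ i, s i))

namespace ComplexRadonMeasure

/-- The value of a complex Radon measure on the empty set is `0`. -/
theorem apply_empty (μ : ComplexRadonMeasure X) : μ.toFun ∅ = 0 := by
  have h := μ.hasSum_iUnion ∅ isCompact_empty (fun _ => ∅) (fun _ => MeasurableSet.empty)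
    (fun _ => subset_rfl) (fun _ _ _ => disjoint_bot_left)
  exact (summable_const_iff _).1 h.summable

variable [T2Space X] [OpensMeasurableSpace X]

open Classical in
/-- The restriction of `μ` to a compact set `K`: the (finite) complex measure `s ↦ μ (s ∩ K)`. -/
def onCompact (μ : ComplexRadonMeasure X) (K : TopologicalSpace.Compacts X) :
    ComplexMeasure X where
  measureOf' s := if MeasurableSet s then μ.toFun (s ∩ K) else 0
  empty' := by simp [μ.apply_empty]
  not_measurable' s hs := by simp [hs]
  m_iUnion' s hs hd := by
    have hK : MeasurableSet (K : Set X) := K.isCompact.isClosed.measurableSet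
    have h := μ.hasSum_iUnion K K.isCompact (fun i => s i ∩ K) (fun i => (hs i).inter hK)
      (fun i => Set.inter_subset_right)
      (fun i j hij => (hd hij).mono Set.inter_subset_left Set.inter_subset_left)
    rw [if_pos (MeasurableSet.iUnion hs), Set.iUnion_inter]
    simpa [hs] using h

/-- The total variation `|μ|`, a positive measure, finite or not: the supremum of the total
variations of the restrictions of `μ` to compact sets. -/
def variation (μ : ComplexRadonMeasure X) : Measure X :=
  ⨆ K : TopologicalSpace.Compacts X, (μ.onCompact K).variation

open Classical in
/-- `∫ g dμ` for `g ∈ L¹(|μ|)`: the limit of the integrals of `g` over compact sets `K`, along the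
directed family of all compact sets. It is `0` by convention if `g ∉ L¹(|μ|)`. -/
def integral (μ : ComplexRadonMeasure X) (g : X → ℂ) : ℂ :=
  if Integrable g μ.variation then
    limUnder atTop (fun K : TopologicalSpace.Compacts X =>
      VectorMeasure.integral (μ.onCompact K) g (ContinuousLinearMap.mul ℝ ℂ))
  else 0

end ComplexRadonMeasure

end Radon

/-- `‖μ‖_{𝓜(ℂ ∖ F)} = sup_{z ∈ F} ∫_{ℂ ∖ F} d|μ|(ζ) / |ζ - z|²`, with values in `[0, ∞]`. -/
def mNorm (F : Set ℂ) (μ : ComplexRadonMeasure ↥Fᶜ) : ℝ≥0∞ :=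
  ⨆ z ∈ F, ∫⁻ ζ : ↥Fᶜ, (‖(ζ : ℂ) - z‖ₑ ^ 2)⁻¹ ∂μ.variation

/-- The space `𝓜(ℂ ∖ F)` of the complex Radon measures on `ℂ ∖ F` of finite `mNorm`. -/
def mSpace (F : Set ℂ) : Set (ComplexRadonMeasure ↥Fᶜ) :=
  {μ | mNorm F μ < ∞}

/-- The modified Cauchy integral `z ↦ ∫_{ℂ ∖ F} (1 / (ζ - z) - 1 / (ζ - z₀)) dμ(ζ)`. -/
def modifiedCauchy (F : Set ℂ) (μ : ComplexRadonMeasure ↥Fᶜ) (z₀ z : ℂ) : ℂ :=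
  μ.integral (fun ζ : ↥Fᶜ => 1 / ((ζ : ℂ) - z) - 1 / ((ζ : ℂ) - z₀))

/-- `f = c + (modified Cauchy integral of μ)` on `F`, for some constant `c`. Functions on `F` are
given here and below by functions on `ℂ`, of which only the values on `F` matter. -/
def Represents (F : Set ℂ) (z₀ : ℂ) (f : ℂ → ℂ) (μ : ComplexRadonMeasure ↥Fᶜ) : Prop :=
  ∃ c : ℂ, ∀ z ∈ F, f z = c + modifiedCauchy F μ z₀ z

/-- The space of the functions on `F` of the form `c + (modified Cauchy integral of μ)`, where `c`
is a constant and `μ ∈ 𝓜(ℂ ∖ F)`. -/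
def mHat (F : Set ℂ) (z₀ : ℂ) : Set (ℂ → ℂ) :=
  {f | ∃ μ ∈ mSpace F, Represents F z₀ f μ}

/-- The infimum of `‖μ‖_{𝓜(ℂ ∖ F)}` over the `μ ∈ 𝓜(ℂ ∖ F)` for which `f` differs from the modified
Cauchy integral of `μ` by a constant on `F`. -/
def mHatNorm (F : Set ℂ) (z₀ : ℂ) (f : ℂ → ℂ) : ℝ≥0∞ :=
  ⨅ μ ∈ {μ | μ ∈ mSpace F ∧ Represents F z₀ f μ}, mNorm F μ

/-- `‖f(N) R - R f(N)‖ ≤ C ‖N R - R N‖` for all bounded operators `R` and all bounded normal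
operators `N` with spectrum in `F`, on all complex Hilbert spaces; `f(N)` is given by the continuous
functional calculus. -/
def CommutatorBound (F : Set ℂ) (f : ℂ → ℂ) (C : ℝ≥0) : Prop :=
  ∀ (H : Type u) [NormedAddCommGroup H] [InnerProductSpace ℂ H] [CompleteSpace H]
    (N R : H →L[ℂ] H), IsStarNormal N → spectrum ℂ N ⊆ F →
      ‖cfc f N * R - R * cfc f N‖ ≤ C * ‖N * R - R * N‖

/-- The space `CL(F)` of commutator Lipschitz functions on `F`. -/
def CL (F : Set ℂ) : Set (ℂ → ℂ) :=
  {f | ContinuousOn f F ∧ ∃ C : ℝ≥0, CommutatorBound.{u} F f C}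

/-- `‖f‖_{CL(F)}`: the least admissible constant in the definition of `CL(F)`, and `∞` for functions
that are not in `CL(F)`. -/
def clNorm (F : Set ℂ) (f : ℂ → ℂ) : ℝ≥0∞ :=
  ⨅ C ∈ {C : ℝ≥0 | ContinuousOn f F ∧ CommutatorBound.{u} F f C}, (C : ℝ≥0∞)

end CauchyCL

end

/-! For `ζ` off `F` let `r_ζ = (ζ - N)⁻¹`. Then `[r_ζ, R] = r_ζ [N, R] r_ζ`, and scalars commute
with `R`, so formally `[f(N), R] = ∫ r_ζ [N, R] r_ζ dμ(ζ)`. Paired with unit vectors `x`, `y`, this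
is at most `‖[N, R]‖ ∫ ‖r_ζ x‖ ‖r_ζ* y‖ d|μ|`. Now `∫ ‖r_ζ x‖² d|μ|` is the quadratic form at `x` of
the function `z ↦ ∫ |ζ - z|⁻² d|μ|` of `N`, hence at most `‖μ‖`; by normality the same holds for
`r_ζ*` and `y`. So `‖μ‖` is an admissible constant. Since `|μ|` may be infinite, the estimate is
proved over compact sets (`norm_cfcCommutator_compactCauchy_le`). It passes to the limit because the
truncated Cauchy integrals converge uniformly on the spectrum (`tendsto_compactCauchy`). -/

/-! ### Two general facts on integration. -/

namespace MeasureTheory.VectorMeasure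

/-- Integration against a vector measure intertwines continuous linear maps that are compatible
with the pairings. -/
theorem map_integral {X E E' F G G' : Type*} [MeasurableSpace X]
    [NormedAddCommGroup E] [NormedSpace ℝ E] [NormedAddCommGroup E'] [NormedSpace ℝ E']
    [NormedAddCommGroup F] [NormedSpace ℝ F]
    [NormedAddCommGroup G] [NormedSpace ℝ G] [CompleteSpace G]
    [NormedAddCommGroup G'] [NormedSpace ℝ G'] [CompleteSpace G']
    {μ : VectorMeasure X F} {B : E →L[ℝ] F →L[ℝ] G} {B' : E' →L[ℝ] F →L[ℝ] G'}
    (T : G →L[ℝ] G') (S : E →L[ℝ] E') (h : ∀ e v, T (B e v) = B' (S e) v)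
    {f : X → E} (hf : Integrable f μ.variation) :
    T (integral μ f B) = integral μ (fun x => S (f x)) B' := by
  refine Integrable.induction
    (fun f => T (integral μ f B) = integral μ (fun x => S (f x)) B') ?_ ?_ ?_ ?_ hf
  · intro c s hs hμs
    have : IsFiniteMeasure (μ.variation.restrict s) := ⟨by simpa using hμs⟩
    have hS : (fun x => S (s.indicator (fun _ => c) x)) = s.indicator (fun _ => S c) := by
      ext x
      by_cases hx : x ∈ s <;> simp [hx]
    rw [integral_indicator_const c hs, hS, integral_indicator_const (S c) hs, h]
  · intro f g _ hf hg ihf ihg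
    simp only [Pi.add_apply, _root_.map_add]
    rw [show integral μ (f + g) B = _ from integral_fun_add hf hg, _root_.map_add, ihf, ihg,
      integral_fun_add (S.integrable_comp hf) (S.integrable_comp hg)]
  · refine isClosed_eq (T.continuous.comp continuous_integral) ?_
    have : (fun f : X →₁[μ.variation] E => integral μ (fun x => S (f x)) B') =
        fun f : X →₁[μ.variation] E => integral μ (fun x => S.compLp f x) B' := by
      ext f
      exact integral_congr_ae (EventuallyEq.symm (S.coeFn_compLp f))
    rw [this]
    exact continuous_integral.comp (S.compLpL 1 μ.variation).continuous
  · intro f g hfg _ ih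
    rw [← integral_congr_ae hfg, ih]
    exact integral_congr_ae (hfg.fun_comp S)

end MeasureTheory.VectorMeasure

/-- The integral of an integrable function off a compact set tends to `0` as the compact set
increases. -/
theorem tendsto_setLIntegral_compl_compacts {X : Type*} [MetricSpace X] [SecondCountableTopology X]
    [LocallyCompactSpace X] [MeasurableSpace X] [BorelSpace X] {μ : Measure X} {g : X → ℝ≥0∞}
    (hg : ∫⁻ x, g x ∂μ ≠ ∞) :
    Tendsto (fun K : TopologicalSpace.Compacts X => ∫⁻ x in (K : Set X)ᶜ, g x ∂μ) atTop (𝓝 0) := by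
  have : IsFiniteMeasure (μ.withDensity g) := isFiniteMeasure_withDensity hg
  rw [ENNReal.tendsto_nhds_zero]
  intro ε hε
  -- Inner regularity of the finite measure `g μ`.
  obtain ⟨K, -, hK, hKε⟩ := MeasurableSet.univ.exists_isCompact_sdiff_lt
    (measure_ne_top (μ.withDensity g) _) hε.ne'
  filter_upwards [eventually_ge_atTop (⟨K, hK⟩ : TopologicalSpace.Compacts X)] with K' hK'
  rw [← withDensity_apply _ K'.isCompact.measurableSet.compl]
  refine (measure_mono ?_).trans hKε.le
  rw [← Set.compl_eq_univ_sdiff]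
  exact Set.compl_subset_compl.2 hK'

/-! ### Integration against a complex Radon measure. -/

namespace CauchyCL

namespace ComplexRadonMeasure

section

variable {X : Type*} [TopologicalSpace X] [MeasurableSpace X] [T2Space X] [OpensMeasurableSpace X]
  (μ : ComplexRadonMeasure X) {K K' : TopologicalSpace.Compacts X} {g : X → ℂ}

theorem variation_onCompact_le (K : TopologicalSpace.Compacts X) :
    (μ.onCompact K).variation ≤ μ.variation :=
  le_iSup (fun K => (μ.onCompact K).variation) K

theorem onCompact_apply (K : TopologicalSpace.Compacts X) {s : Set X} (hs : MeasurableSet s) :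
    μ.onCompact K s = μ.toFun (s ∩ K) :=
  if_pos hs

theorem restrict_onCompact (h : K ≤ K') : (μ.onCompact K').restrict K = μ.onCompact K := by
  have hK : MeasurableSet (K : Set X) := K.isCompact.measurableSet
  ext s hs
  have : (K : Set X) ⊆ K' := h
  rw [VectorMeasure.restrict_apply _ hK hs, onCompact_apply _ _ hs, onCompact_apply _ _ (hs.inter hK),
    Set.inter_assoc, Set.inter_eq_left.2 this]

theorem variation_onCompact_restrict (K : TopologicalSpace.Compacts X) :
    (μ.onCompact K).variation.restrict K = (μ.onCompact K).variation := by
  rw [← VectorMeasure.variation_restrict K.isCompact.measurableSet, restrict_onCompact μ le_rfl]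

theorem integrable_onCompact (K : TopologicalSpace.Compacts X) (hg : Integrable g μ.variation) :
    Integrable g (μ.onCompact K).variation :=
  hg.mono_measure (μ.variation_onCompact_le K)

/-- The integral of `g` over the compact set `K`. -/
noncomputable def compactIntegral (K : TopologicalSpace.Compacts X) (g : X → ℂ) : ℂ :=
  VectorMeasure.integral (μ.onCompact K) g (ContinuousLinearMap.mul ℝ ℂ)

theorem enorm_compactIntegral_le (K : TopologicalSpace.Compacts X) (g : X → ℂ) :
    ‖μ.compactIntegral K g‖ₑ ≤ ∫⁻ x, ‖g x‖ₑ ∂(μ.onCompact K).variation := by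
  refine VectorMeasure.enorm_integral_le_lintegral_enorm.trans ?_
  have : ‖ContinuousLinearMap.mul ℝ ℂ‖ₑ ≤ 1 := by
    rw [← ofReal_norm]
    simp
  exact (mul_le_mul_left this _).trans_eq (one_mul _)

/-- The difference is the integral over `K' \ K`. The bound does not depend on `K'`, so it yields
both the Cauchy property of the net and its rate of convergence. -/
theorem enorm_compactIntegral_sub_le (h : K ≤ K') (hg : Integrable g μ.variation) :
    ‖μ.compactIntegral K' g - μ.compactIntegral K g‖ₑ ≤
      ∫⁻ x in (K : Set X)ᶜ, ‖g x‖ₑ ∂μ.variation := by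
  have hK : MeasurableSet (K : Set X) := K.isCompact.measurableSet
  have h1 : μ.compactIntegral K' g - μ.compactIntegral K g =
      VectorMeasure.integral ((μ.onCompact K').restrict (K : Set X)ᶜ) g
        (ContinuousLinearMap.mul ℝ ℂ) := by
    rw [VectorMeasure.setIntegral_compl hK (μ.integrable_onCompact K' hg), restrict_onCompact μ h]
    rfl
  rw [h1]
  refine VectorMeasure.enorm_integral_le_lintegral_enorm.trans ?_
  have : ‖ContinuousLinearMap.mul ℝ ℂ‖ₑ ≤ 1 := by
    rw [← ofReal_norm]
    simp
  refine (mul_le_mul_left this _).trans ?_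
  rw [one_mul, VectorMeasure.variation_restrict hK.compl]
  exact lintegral_mono' (Measure.restrict_mono le_rfl (μ.variation_onCompact_le K')) le_rfl

end

section

variable {X : Type*} [MetricSpace X] [SecondCountableTopology X] [LocallyCompactSpace X]
  [MeasurableSpace X] [BorelSpace X] (μ : ComplexRadonMeasure X) {g h : X → ℂ}

/-- The `limUnder` in `integral` is meaningful only once the limit exists; it does, since the net is
Cauchy in `ℂ`. -/
theorem tendsto_compactIntegral (hg : Integrable g μ.variation) :
    Tendsto (fun K => μ.compactIntegral K g) atTop (𝓝 (μ.integral g)) := by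
  have hc : Cauchy (map (fun K => μ.compactIntegral K g) atTop) := by
    refine (EMetric.cauchySeq_iff (u := fun K => μ.compactIntegral K g)).2 fun ε hε => ?_
    have hlim := tendsto_setLIntegral_compl_compacts (hasFiniteIntegral_iff_enorm.1 hg.2).ne
    obtain ⟨K, hK⟩ := ((tendsto_order.1 hlim).2 (ε / 2) (ENNReal.half_pos hε.ne')).exists
    refine ⟨K, fun K₁ h₁ K₂ h₂ => ?_⟩
    refine (edist_triangle_right _ _ (μ.compactIntegral K g)).trans_lt ?_
    rw [edist_eq_enorm_sub, edist_eq_enorm_sub]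
    calc _ < ε / 2 + ε / 2 := ENNReal.add_lt_add
            ((μ.enorm_compactIntegral_sub_le h₁ hg).trans_lt hK)
            ((μ.enorm_compactIntegral_sub_le h₂ hg).trans_lt hK)
      _ = ε := ENNReal.add_halves ε
  rw [integral, if_pos hg]
  exact (cauchy_map_iff_exists_tendsto.1 hc).elim fun a ha => tendsto_nhds_limUnder ⟨a, ha⟩

theorem enorm_integral_sub_compactIntegral_le (K : TopologicalSpace.Compacts X)
    (hg : Integrable g μ.variation) :
    ‖μ.integral g - μ.compactIntegral K g‖ₑ ≤ ∫⁻ x in (K : Set X)ᶜ, ‖g x‖ₑ ∂μ.variation :=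
  le_of_tendsto ((μ.tendsto_compactIntegral hg).sub_const _).enorm <|
    (eventually_ge_atTop K).mono fun _ h => μ.enorm_compactIntegral_sub_le h hg

theorem integral_sub (hg : Integrable g μ.variation) (hh : Integrable h μ.variation) :
    μ.integral (fun x => g x - h x) = μ.integral g - μ.integral h := by
  refine tendsto_nhds_unique (μ.tendsto_compactIntegral (hg.sub hh))
    (((μ.tendsto_compactIntegral hg).sub (μ.tendsto_compactIntegral hh)).congr fun K => ?_)
  exact (VectorMeasure.integral_fun_sub (μ.integrable_onCompact K hg)
    (μ.integrable_onCompact K hh)).symm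

theorem enorm_integral_le (hg : Integrable g μ.variation) :
    ‖μ.integral g‖ₑ ≤ ∫⁻ x, ‖g x‖ₑ ∂μ.variation :=
  le_of_tendsto (μ.tendsto_compactIntegral hg).enorm <| .of_forall fun K =>
    (μ.enorm_compactIntegral_le K g).trans
      (lintegral_mono' (μ.variation_onCompact_le K) le_rfl)

end

end ComplexRadonMeasure

end CauchyCL

/-! ### Scalar estimates for the modified Cauchy integral. -/

namespace CauchyCL

variable {F : Set ℂ}

theorem coe_sub_ne_zero (ζ : ↥Fᶜ) {z : ℂ} (hz : z ∈ F) : (ζ : ℂ) - z ≠ 0 :=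
  sub_ne_zero.2 fun h => ζ.2 (h ▸ hz)

theorem continuous_one_div_coe_sub {z : ℂ} (hz : z ∈ F) :
    Continuous fun ζ : ↥Fᶜ => 1 / ((ζ : ℂ) - z) :=
  continuous_const.div (continuous_subtype_val.sub continuous_const) fun ζ => coe_sub_ne_zero ζ hz

theorem enorm_one_div_sub_one_div (ζ : ↥Fᶜ) {z w : ℂ} (hz : z ∈ F) (hw : w ∈ F) :
    ‖1 / ((ζ : ℂ) - z) - 1 / ((ζ : ℂ) - w)‖ₑ =
      ‖z - w‖ₑ * (‖(ζ : ℂ) - z‖ₑ⁻¹ * ‖(ζ : ℂ) - w‖ₑ⁻¹) := by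
  have hz' := coe_sub_ne_zero ζ hz
  have hw' := coe_sub_ne_zero ζ hw
  rw [← enorm_inv hz', ← enorm_inv hw', ← enorm_mul, ← enorm_mul]
  congr 1
  field_simp
  ring

theorem measurable_enorm_coe_sub_inv (z : ℂ) : Measurable fun ζ : ↥Fᶜ => ‖(ζ : ℂ) - z‖ₑ⁻¹ :=
  (measurable_subtype_coe.sub_const z).enorm.inv

/-- Cauchy–Schwarz. Keeping the factors at `z` and `w` apart matters for tails: with `w = z₀` fixed,
that factor is small independently of `z`. -/
theorem setLIntegral_enorm_one_div_sub_le (ν : Measure ↥Fᶜ) (s : Set ↥Fᶜ) {z w : ℂ} (hz : z ∈ F)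
    (hw : w ∈ F) :
    ∫⁻ ζ in s, ‖1 / ((ζ : ℂ) - z) - 1 / ((ζ : ℂ) - w)‖ₑ ∂ν ≤
      ‖z - w‖ₑ * ((∫⁻ ζ in s, (‖(ζ : ℂ) - z‖ₑ ^ 2)⁻¹ ∂ν) ^ (1 / 2 : ℝ) *
        (∫⁻ ζ in s, (‖(ζ : ℂ) - w‖ₑ ^ 2)⁻¹ ∂ν) ^ (1 / 2 : ℝ)) := by
  simp_rw [fun ζ : ↥Fᶜ => enorm_one_div_sub_one_div ζ hz hw]
  rw [lintegral_const_mul' _ _ enorm_ne_top]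
  gcongr
  refine (ENNReal.lintegral_mul_le_Lp_mul_Lq _ Real.HolderConjugate.two_two
    (measurable_enorm_coe_sub_inv z).aemeasurable
    (measurable_enorm_coe_sub_inv w).aemeasurable).trans_eq ?_
  simp only [ENNReal.rpow_two, ENNReal.inv_pow]

variable {μ : ComplexRadonMeasure ↥Fᶜ}

theorem lintegral_le_mNorm (μ : ComplexRadonMeasure ↥Fᶜ) {z : ℂ} (hz : z ∈ F) :
    ∫⁻ ζ : ↥Fᶜ, (‖(ζ : ℂ) - z‖ₑ ^ 2)⁻¹ ∂μ.variation ≤ mNorm F μ :=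
  le_iSup₂ (f := fun z (_ : z ∈ F) => ∫⁻ ζ : ↥Fᶜ, (‖(ζ : ℂ) - z‖ₑ ^ 2)⁻¹ ∂μ.variation) z hz

theorem lintegral_enorm_one_div_sub_le (μ : ComplexRadonMeasure ↥Fᶜ) {z w : ℂ} (hz : z ∈ F)
    (hw : w ∈ F) :
    ∫⁻ ζ : ↥Fᶜ, ‖1 / ((ζ : ℂ) - z) - 1 / ((ζ : ℂ) - w)‖ₑ ∂μ.variation ≤
      mNorm F μ * ‖z - w‖ₑ := by
  have h := setLIntegral_enorm_one_div_sub_le μ.variation Set.univ hz hw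
  rw [Measure.restrict_univ] at h
  calc _ ≤ _ := h
    _ ≤ ‖z - w‖ₑ * (mNorm F μ ^ (1 / 2 : ℝ) * mNorm F μ ^ (1 / 2 : ℝ)) := by
      gcongr
      · exact lintegral_le_mNorm μ hz
      · exact lintegral_le_mNorm μ hw
    _ = mNorm F μ * ‖z - w‖ₑ := by
      rw [← ENNReal.rpow_add_of_nonneg _ _ (by norm_num) (by norm_num), mul_comm]
      norm_num

theorem integrable_one_div_sub (hμ : μ ∈ mSpace F) {z w : ℂ} (hz : z ∈ F) (hw : w ∈ F) :
    Integrable (fun ζ : ↥Fᶜ => 1 / ((ζ : ℂ) - z) - 1 / ((ζ : ℂ) - w)) μ.variation := by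
  refine ⟨((continuous_one_div_coe_sub hz).sub
    (continuous_one_div_coe_sub hw)).aestronglyMeasurable, ?_⟩
  exact (lintegral_enorm_one_div_sub_le μ hz hw).trans_lt (ENNReal.mul_lt_top hμ enorm_lt_top)

/-- The modified Cauchy integral is Lipschitz. -/
theorem enorm_modifiedCauchy_sub_le (hF : IsClosed F) (hμ : μ ∈ mSpace F) {z₀ z w : ℂ}
    (hz₀ : z₀ ∈ F) (hz : z ∈ F) (hw : w ∈ F) :
    ‖modifiedCauchy F μ z₀ z - modifiedCauchy F μ z₀ w‖ₑ ≤ mNorm F μ * ‖z - w‖ₑ := by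
  have : LocallyCompactSpace ↥Fᶜ := hF.isOpen_compl.locallyCompactSpace
  rw [modifiedCauchy, modifiedCauchy, ← μ.integral_sub (integrable_one_div_sub hμ hz hz₀)
    (integrable_one_div_sub hμ hw hz₀)]
  simp only [sub_sub_sub_cancel_right]
  exact (μ.enorm_integral_le (integrable_one_div_sub hμ hz hw)).trans
    (lintegral_enorm_one_div_sub_le μ hz hw)

theorem continuousOn_modifiedCauchy (hF : IsClosed F) (hμ : μ ∈ mSpace F) {z₀ : ℂ}
    (hz₀ : z₀ ∈ F) : ContinuousOn (modifiedCauchy F μ z₀) F := by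
  refine LipschitzOnWith.continuousOn (K := (mNorm F μ).toNNReal) fun z hz w hw => ?_
  rw [edist_eq_enorm_sub, edist_eq_enorm_sub, ENNReal.coe_toNNReal hμ.ne]
  exact enorm_modifiedCauchy_sub_le hF hμ hz₀ hz hw

/-- The modified Cauchy integral is the limit of the integrals over compact sets, uniformly on the
bounded subsets of `F`. -/
theorem enorm_modifiedCauchy_sub_compactIntegral_le (hF : IsClosed F) (hμ : μ ∈ mSpace F)
    (K : TopologicalSpace.Compacts ↥Fᶜ) {z₀ z : ℂ} (hz₀ : z₀ ∈ F) (hz : z ∈ F) :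
    ‖modifiedCauchy F μ z₀ z -
        μ.compactIntegral K (fun ζ => 1 / ((ζ : ℂ) - z) - 1 / ((ζ : ℂ) - z₀))‖ₑ ≤
      ‖z - z₀‖ₑ * (mNorm F μ ^ (1 / 2 : ℝ) *
        (∫⁻ ζ in (K : Set ↥Fᶜ)ᶜ, (‖(ζ : ℂ) - z₀‖ₑ ^ 2)⁻¹ ∂μ.variation) ^ (1 / 2 : ℝ)) := by
  have : LocallyCompactSpace ↥Fᶜ := hF.isOpen_compl.locallyCompactSpace
  refine (μ.enorm_integral_sub_compactIntegral_le K (integrable_one_div_sub hμ hz hz₀)).trans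
    ((setLIntegral_enorm_one_div_sub_le _ _ hz hz₀).trans ?_)
  gcongr
  exact (setLIntegral_le_lintegral _ _).trans (lintegral_le_mNorm μ hz)

theorem tendsto_setLIntegral_compl_rpow (hF : IsClosed F) (hμ : μ ∈ mSpace F) {z : ℂ}
    (hz : z ∈ F) :
    Tendsto (fun K : TopologicalSpace.Compacts ↥Fᶜ => (∫⁻ ζ in (K : Set ↥Fᶜ)ᶜ,
      (‖(ζ : ℂ) - z‖ₑ ^ 2)⁻¹ ∂μ.variation) ^ (1 / 2 : ℝ)) atTop (𝓝 0) := by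
  have : LocallyCompactSpace ↥Fᶜ := hF.isOpen_compl.locallyCompactSpace
  have h := tendsto_setLIntegral_compl_compacts ((lintegral_le_mNorm μ hz).trans_lt hμ).ne
  have h2 := (ENNReal.continuous_rpow_const (y := (1 / 2 : ℝ))).tendsto 0 |>.comp h
  rwa [ENNReal.zero_rpow_of_pos (by norm_num)] at h2

/-- `|μ|` is finite on compact sets. -/
theorem variation_compact_lt_top (hμ : μ ∈ mSpace F) {z : ℂ} (hz : z ∈ F)
    (K : TopologicalSpace.Compacts ↥Fᶜ) : μ.variation K < ∞ := by
  obtain ⟨C, hC⟩ := K.isCompact.exists_bound_of_continuousOn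
    (f := fun ζ : ↥Fᶜ => (ζ : ℂ) - z) (by fun_prop)
  have hK : MeasurableSet (K : Set ↥Fᶜ) := K.isCompact.measurableSet
  have h : (ENNReal.ofReal C ^ 2)⁻¹ * μ.variation K < ∞ := by
    refine lt_of_le_of_lt ?_ ((lintegral_le_mNorm μ hz).trans_lt hμ)
    rw [← setLIntegral_const]
    refine (setLIntegral_mono' hK fun ζ hζ => ?_).trans (setLIntegral_le_lintegral _ _)
    gcongr
    rw [← ofReal_norm]
    exact ENNReal.ofReal_le_ofReal (hC ζ hζ)
  -- The factor `(ENNReal.ofReal C ^ 2)⁻¹` is nonzero because `ENNReal.ofReal C` is finite.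
  refine ENNReal.lt_top_of_mul_ne_top_right h.ne ?_
  simp

end CauchyCL

/-! ### The Cauchy kernel in the functional calculus and the commutator estimate. -/

namespace CauchyCL

variable {F : Set ℂ} {μ : ComplexRadonMeasure ↥Fᶜ}

/-- The Cauchy kernel `ζ ↦ (z ↦ 1 / (ζ - z))`, as a continuous function on `ℂ ∖ F` with values in
the continuous functions on `σ ⊆ F`. -/
noncomputable def cauchyKernel {σ : Set ℂ} (hσ : σ ⊆ F) : C(↥Fᶜ, C(σ, ℂ)) :=
  ContinuousMap.curry
    ⟨fun p => 1 / ((p.1 : ℂ) - p.2), continuous_const.div (by fun_prop) fun p =>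
      coe_sub_ne_zero p.1 (hσ p.2.2)⟩

@[simp]
theorem cauchyKernel_apply {σ : Set ℂ} (hσ : σ ⊆ F) (ζ : ↥Fᶜ) (z : σ) :
    cauchyKernel hσ ζ z = 1 / ((ζ : ℂ) - z) :=
  rfl

theorem isFiniteMeasure_variation_onCompact (hμ : μ ∈ mSpace F) {z : ℂ} (hz : z ∈ F)
    (K : TopologicalSpace.Compacts ↥Fᶜ) : IsFiniteMeasure (μ.onCompact K).variation := by
  refine ⟨?_⟩
  rw [← μ.variation_onCompact_restrict, Measure.restrict_apply_univ]
  exact (μ.variation_onCompact_le K _).trans_lt (variation_compact_lt_top hμ hz K)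

theorem integrable_onCompact_of_continuous {E : Type*} [NormedAddCommGroup E] (hμ : μ ∈ mSpace F)
    {z : ℂ} (hz : z ∈ F) (K : TopologicalSpace.Compacts ↥Fᶜ) {g : ↥Fᶜ → E} (hg : Continuous g) :
    Integrable g (μ.onCompact K).variation := by
  have := isFiniteMeasure_variation_onCompact hμ hz K
  rw [← μ.variation_onCompact_restrict]
  exact hg.continuousOn.integrableOn_compact K.isCompact

section Operator

variable {H : Type*} [NormedAddCommGroup H] [InnerProductSpace ℂ H] [CompleteSpace H]
  {N : H →L[ℂ] H}

theorem cfcHom_cauchyKernel_commutator (hN : IsStarNormal N) (hσ : spectrum ℂ N ⊆ F) (ζ : ↥Fᶜ)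
    (R : H →L[ℂ] H) :
    cfcHom hN (cauchyKernel hσ ζ) * R - R * cfcHom hN (cauchyKernel hσ ζ) =
      cfcHom hN (cauchyKernel hσ ζ) * (N * R - R * N) * cfcHom hN (cauchyKernel hσ ζ) := by
  set r := cfcHom hN (cauchyKernel hσ ζ) with hr
  have h : (algebraMap ℂ C(spectrum ℂ N, ℂ) ζ -
      ContinuousMap.restrict (spectrum ℂ N) (ContinuousMap.id ℂ)) * cauchyKernel hσ ζ = 1 := by
    ext z
    exact mul_one_div_cancel (coe_sub_ne_zero ζ (hσ z.2))
  have h1 : (algebraMap ℂ (H →L[ℂ] H) ζ - N) * r = 1 := by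
    have := congrArg (cfcHom hN) h
    rwa [map_mul, map_sub, AlgHomClass.commutes, cfcHom_id, map_one] at this
  have h2 : r * (algebraMap ℂ (H →L[ℂ] H) ζ - N) = 1 := by
    have := congrArg (cfcHom hN) ((mul_comm _ _).trans h)
    rwa [map_mul, map_sub, AlgHomClass.commutes, cfcHom_id, map_one] at this
  -- The scalar `ζ` is central; multiplying by the resolvent on both sides then cancels one factor
  -- `ζ - N` in each term.
  have hc : N * R - R * N = R * (algebraMap ℂ (H →L[ℂ] H) ζ - N) -
      (algebraMap ℂ (H →L[ℂ] H) ζ - N) * R := by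
    rw [mul_sub, sub_mul, Algebra.commutes (ζ : ℂ) R]
    abel
  rw [hc, mul_sub, sub_mul, ← mul_assoc r _ R, h2, one_mul, mul_assoc, mul_assoc, h1, mul_one]

theorem norm_cfcHom_apply_sq (hN : IsStarNormal N) (φ : C(spectrum ℂ N, ℂ)) (x : H) :
    ‖cfcHom hN φ x‖ ^ 2 = (inner ℂ x (cfcHom hN (star φ * φ) x)).re := by
  rw [map_mul, map_star, ContinuousLinearMap.star_eq_adjoint]
  exact ContinuousLinearMap.apply_norm_sq_eq_inner_adjoint_right (cfcHom hN φ) x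

/-- The integral moves inside the functional calculus, giving `⟪x, Φ(N) x⟫` with `Φ(z) = ∫ |ζ - z|⁻²
d|μ|` over `K`. The calculus is isometric, and the sup norm of `Φ` on the spectrum is at most `‖μ‖`.
-/
theorem integral_norm_cfcHom_cauchyKernel_sq_le (hN : IsStarNormal N) (hσ : spectrum ℂ N ⊆ F)
    (hμ : μ ∈ mSpace F) {z₀ : ℂ} (hz₀ : z₀ ∈ F) (K : TopologicalSpace.Compacts ↥Fᶜ) (x : H) :
    ∫ ζ, ‖cfcHom hN (cauchyKernel hσ ζ) x‖ ^ 2 ∂(μ.onCompact K).variation ≤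
      (mNorm F μ).toReal * ‖x‖ ^ 2 := by
  set ν := (μ.onCompact K).variation
  let T : C(spectrum ℂ N, ℂ) →L[ℝ] ℝ := Complex.reCLM ∘L
    ((innerSL ℂ x ∘L ContinuousLinearMap.apply ℂ H x ∘L cfcL (a := N) hN).restrictScalars ℝ)
  have hT (φ) : T φ = (inner ℂ x (cfcHom hN φ x)).re := rfl
  have hint : Integrable (fun ζ => star (cauchyKernel hσ ζ) * cauchyKernel hσ ζ) ν :=
    integrable_onCompact_of_continuous hμ hz₀ K (by fun_prop)
  simp_rw [norm_cfcHom_apply_sq, ← hT]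
  rw [T.integral_comp_comm hint, hT]
  set Φ := ∫ ζ, star (cauchyKernel hσ ζ) * cauchyKernel hσ ζ ∂ν
  have hΦ : ‖Φ‖ ≤ (mNorm F μ).toReal := by
    refine (ContinuousMap.norm_le _ ENNReal.toReal_nonneg).2 fun z => ?_
    rw [ContinuousMap.integral_apply hint, ← toReal_enorm]
    refine ENNReal.toReal_mono hμ.ne ((enorm_integral_le_lintegral_enorm _).trans ?_)
    refine le_trans ?_ (lintegral_le_mNorm μ (hσ z.2))
    refine lintegral_mono' (μ.variation_onCompact_le K) fun ζ => ?_
    rw [ContinuousMap.mul_apply, ContinuousMap.star_apply, enorm_mul,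
      enorm_eq_nnnorm (star _), nnnorm_star, ← enorm_eq_nnnorm, cauchyKernel_apply, one_div, enorm_inv (coe_sub_ne_zero ζ (hσ z.2)), ← sq, ENNReal.inv_pow]
  calc (inner ℂ x (cfcHom hN Φ x)).re ≤ ‖inner ℂ x (cfcHom hN Φ x)‖ := Complex.re_le_norm _
    _ ≤ ‖x‖ * (‖cfcHom hN Φ‖ * ‖x‖) :=
      (norm_inner_le_norm _ _).trans (by gcongr; exact (cfcHom hN Φ).le_opNorm x)
    _ = ‖Φ‖ * ‖x‖ ^ 2 := by rw [norm_cfcHom (𝕜 := ℂ) N Φ hN]; ring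
    _ ≤ _ := by gcongr

/-- The commutator `[φ(N), R]` as a continuous linear function of `φ`. -/
noncomputable def cfcCommutator (hN : IsStarNormal N) (R : H →L[ℂ] H) :
    C(spectrum ℂ N, ℂ) →L[ℂ] H →L[ℂ] H :=
  ((ContinuousLinearMap.mul ℂ (H →L[ℂ] H)).flip R - ContinuousLinearMap.mul ℂ (H →L[ℂ] H) R) ∘L
    cfcL (a := N) hN

theorem cfcCommutator_apply (hN : IsStarNormal N) (R : H →L[ℂ] H) (φ : C(spectrum ℂ N, ℂ)) :
    cfcCommutator hN R φ = cfcHom hN φ * R - R * cfcHom hN φ :=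
  rfl

theorem cfcCommutator_algebraMap (hN : IsStarNormal N) (R : H →L[ℂ] H) (c : ℂ) :
    cfcCommutator hN R (algebraMap ℂ _ c) = 0 := by
  rw [cfcCommutator_apply, AlgHomClass.commutes, Algebra.commutes, sub_self]

/-- The integral over the compact set `K` of the modified Cauchy kernel, as a continuous function
on `σ ⊆ F`. -/
noncomputable def compactCauchy {σ : Set ℂ} [CompactSpace σ] (hσ : σ ⊆ F)
    (μ : ComplexRadonMeasure ↥Fᶜ) (z₀ : ℂ) (K : TopologicalSpace.Compacts ↥Fᶜ) : C(σ, ℂ) :=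
  VectorMeasure.integral (μ.onCompact K)
    (fun ζ => cauchyKernel hσ ζ - algebraMap ℂ C(σ, ℂ) (1 / ((ζ : ℂ) - z₀)))
    (ContinuousLinearMap.lsmul ℝ ℂ).flip

theorem integrable_modifiedKernel {σ : Set ℂ} [CompactSpace σ] (hσ : σ ⊆ F)
    (hμ : μ ∈ mSpace F) {z₀ : ℂ} (hz₀ : z₀ ∈ F) (K : TopologicalSpace.Compacts ↥Fᶜ) :
    Integrable (fun ζ => cauchyKernel hσ ζ - algebraMap ℂ C(σ, ℂ) (1 / ((ζ : ℂ) - z₀)))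
      (μ.onCompact K).variation :=
  integrable_onCompact_of_continuous hμ hz₀ K
    ((cauchyKernel hσ).continuous.sub
      ((continuous_algebraMap ℂ C(σ, ℂ)).comp (continuous_one_div_coe_sub hz₀)))

/-- Used with `T` a point evaluation and with `T` a matrix coefficient of the commutator. -/
theorem map_compactCauchy {σ : Set ℂ} [CompactSpace σ] (hσ : σ ⊆ F) (hμ : μ ∈ mSpace F) {z₀ : ℂ}
    (hz₀ : z₀ ∈ F) (K : TopologicalSpace.Compacts ↥Fᶜ) (T : C(σ, ℂ) →L[ℂ] ℂ) :
    T (compactCauchy hσ μ z₀ K) = μ.compactIntegral K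
      (fun ζ => T (cauchyKernel hσ ζ - algebraMap ℂ C(σ, ℂ) (1 / ((ζ : ℂ) - z₀)))) := by
  have h (e : C(σ, ℂ)) (v : ℂ) : T.restrictScalars ℝ ((ContinuousLinearMap.lsmul ℝ ℂ).flip e v) =
      ContinuousLinearMap.mul ℝ ℂ (T.restrictScalars ℝ e) v := by
    change T (v • e) = T e * v
    rw [map_smul, smul_eq_mul, mul_comm]
  exact VectorMeasure.map_integral (T.restrictScalars ℝ) (T.restrictScalars ℝ) h
    (integrable_modifiedKernel hσ hμ hz₀ K)

theorem compactCauchy_apply {σ : Set ℂ} [CompactSpace σ] (hσ : σ ⊆ F) (hμ : μ ∈ mSpace F) {z₀ : ℂ}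
    (hz₀ : z₀ ∈ F) (K : TopologicalSpace.Compacts ↥Fᶜ) (z : σ) :
    compactCauchy hσ μ z₀ K z =
      μ.compactIntegral K (fun ζ => 1 / ((ζ : ℂ) - z) - 1 / ((ζ : ℂ) - z₀)) :=
  map_compactCauchy hσ hμ hz₀ K (ContinuousMap.evalCLM ℂ z)

theorem norm_cfcCommutator_compactCauchy_le (hN : IsStarNormal N) (hσ : spectrum ℂ N ⊆ F)
    (hμ : μ ∈ mSpace F) {z₀ : ℂ} (hz₀ : z₀ ∈ F) (K : TopologicalSpace.Compacts ↥Fᶜ)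
    (R : H →L[ℂ] H) :
    ‖cfcCommutator hN R (compactCauchy hσ μ z₀ K)‖ ≤
      (mNorm F μ).toReal * ‖N * R - R * N‖ := by
  set ν := (μ.onCompact K).variation
  set M := (mNorm F μ).toReal
  refine ContinuousLinearMap.opNorm_le_of_re_inner_le (by positivity) fun x y hx hy => ?_
  let T : C(spectrum ℂ N, ℂ) →L[ℂ] ℂ :=
    innerSL ℂ y ∘L ContinuousLinearMap.apply ℂ H x ∘L cfcCommutator hN R
  have hT (φ) : T φ = inner ℂ y (cfcCommutator hN R φ x) := rfl
  let r (ζ : ↥Fᶜ) : H →L[ℂ] H := cfcHom hN (cauchyKernel hσ ζ)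
  have hr : Continuous r := (cfcHom_continuous hN).comp (cauchyKernel hσ).continuous
  -- Normality enters here: the adjoint comes from the conjugate kernel, which has the same modulus.
  have hadj (ζ) : ‖(r ζ).adjoint y‖ ^ 2 = ‖r ζ y‖ ^ 2 := by
    rw [← ContinuousLinearMap.star_eq_adjoint, ← map_star, norm_cfcHom_apply_sq, star_star,
      mul_comm, ← norm_cfcHom_apply_sq]
  -- For unit vectors, `2ab ≤ a² + b²` loses nothing in the final constant: the two square integrals
  -- are each at most `M`, and the factor `1/2` restores `M`.
  have hbound (ζ : ↥Fᶜ) : ‖T (cauchyKernel hσ ζ - algebraMap ℂ _ (1 / ((ζ : ℂ) - z₀)))‖ ≤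
      ‖N * R - R * N‖ / 2 * (‖r ζ y‖ ^ 2 + ‖r ζ x‖ ^ 2) := by
    rw [hT, map_sub, cfcCommutator_algebraMap, sub_zero, cfcCommutator_apply,
      cfcHom_cauchyKernel_commutator]
    change ‖inner ℂ y (r ζ ((N * R - R * N) (r ζ x)))‖ ≤ _
    rw [← ContinuousLinearMap.adjoint_inner_left]
    calc _ ≤ ‖(r ζ).adjoint y‖ * (‖N * R - R * N‖ * ‖r ζ x‖) :=
          (norm_inner_le_norm _ _).trans (by gcongr; exact ContinuousLinearMap.le_opNorm _ _)
      _ = ‖N * R - R * N‖ / 2 * (2 * ‖(r ζ).adjoint y‖ * ‖r ζ x‖) := by ring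
      _ ≤ ‖N * R - R * N‖ / 2 * (‖(r ζ).adjoint y‖ ^ 2 + ‖r ζ x‖ ^ 2) := by
        gcongr
        exact two_mul_le_add_sq _ _
      _ = _ := by rw [hadj]
  have hintx (w : H) : Integrable (fun ζ => ‖r ζ w‖ ^ 2) ν :=
    integrable_onCompact_of_continuous hμ hz₀ K (by fun_prop)
  have hsq (w : H) (hw : ‖w‖ = 1) : ∫ ζ, ‖r ζ w‖ ^ 2 ∂ν ≤ M := by
    simpa [hw] using integral_norm_cfcHom_cauchyKernel_sq_le hN hσ hμ hz₀ K w
  have hmul : ‖ContinuousLinearMap.mul ℝ ℂ‖ ≤ 1 := ContinuousLinearMap.opNorm_mul_le ℝ ℂ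
  calc (inner ℂ (cfcCommutator hN R (compactCauchy hσ μ z₀ K) x) y).re
      = (T (compactCauchy hσ μ z₀ K)).re := by rw [hT]; exact inner_re_symm (𝕜 := ℂ) _ _
    _ ≤ ‖T (compactCauchy hσ μ z₀ K)‖ := Complex.re_le_norm _
    _ ≤ 1 * ∫ ζ, ‖T (cauchyKernel hσ ζ - algebraMap ℂ _ (1 / ((ζ : ℂ) - z₀)))‖ ∂ν := by
      rw [map_compactCauchy hσ hμ hz₀]
      exact VectorMeasure.norm_integral_le_integral_norm.trans (by gcongr)
    _ ≤ ∫ ζ, ‖N * R - R * N‖ / 2 * (‖r ζ y‖ ^ 2 + ‖r ζ x‖ ^ 2) ∂ν := by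
      rw [one_mul]
      exact integral_mono (T.integrable_comp (integrable_modifiedKernel hσ hμ hz₀ K)).norm
        (((hintx y).add (hintx x)).const_mul _) hbound
    _ = ‖N * R - R * N‖ / 2 * (∫ ζ, ‖r ζ y‖ ^ 2 ∂ν + ∫ ζ, ‖r ζ x‖ ^ 2 ∂ν) := by
      rw [integral_const_mul, integral_add (hintx y) (hintx x)]
    _ ≤ ‖N * R - R * N‖ / 2 * (M + M) := by
      gcongr
      · exact hsq y hy
      · exact hsq x hx
    _ = M * ‖N * R - R * N‖ := by ring

end Operator

/-! ### Passage to the limit over compact sets. -/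

theorem tendsto_compactCauchy {σ : Set ℂ} [CompactSpace σ] (hσ : σ ⊆ F) (hF : IsClosed F)
    (hμ : μ ∈ mSpace F) {z₀ : ℂ} (hz₀ : z₀ ∈ F) {f : C(σ, ℂ)}
    (hf : ∀ z : σ, f z = modifiedCauchy F μ z₀ z) :
    Tendsto (compactCauchy hσ μ z₀) atTop (𝓝 f) := by
  -- In the tail bound only `|z - z₀|` depends on `z`, and it is bounded on the compact `σ`.
  obtain ⟨D, hD⟩ := (isCompact_iff_compactSpace.2 ‹CompactSpace σ›).exists_bound_of_continuousOn
    (f := fun z : ℂ => z - z₀) (by fun_prop)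
  have hM : mNorm F μ ^ (1 / 2 : ℝ) ≠ ∞ := ENNReal.rpow_ne_top_of_nonneg (by norm_num) hμ.ne
  have hlim := ENNReal.Tendsto.const_mul (a := ENNReal.ofReal D * mNorm F μ ^ (1 / 2 : ℝ))
    (tendsto_setLIntegral_compl_rpow hF hμ hz₀) (.inr (ENNReal.mul_ne_top ENNReal.ofReal_ne_top hM))
  rw [mul_zero] at hlim
  rw [ContinuousMap.tendsto_iff_tendstoUniformly, EMetric.tendstoUniformly_iff]
  intro ε hε
  filter_upwards [(tendsto_order.1 hlim).2 ε hε] with K hK z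
  rw [hf, compactCauchy_apply hσ hμ hz₀, edist_eq_enorm_sub]
  refine lt_of_le_of_lt ?_ hK
  refine (enorm_modifiedCauchy_sub_compactIntegral_le hF hμ K hz₀ (hσ z.2)).trans ?_
  rw [← mul_assoc]
  gcongr
  rw [← ofReal_norm]
  exact ENNReal.ofReal_le_ofReal (hD z z.2)

theorem Represents.continuousOn {z₀ : ℂ} {f : ℂ → ℂ} (hF : IsClosed F) (hμ : μ ∈ mSpace F)
    (hz₀ : z₀ ∈ F) (hf : Represents F z₀ f μ) : ContinuousOn f F := by
  obtain ⟨c, hc⟩ := hf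
  exact (continuousOn_const.add (continuousOn_modifiedCauchy hF hμ hz₀)).congr hc

theorem Represents.commutatorBound {z₀ : ℂ} {f : ℂ → ℂ} (hF : IsClosed F) (hμ : μ ∈ mSpace F)
    (hz₀ : z₀ ∈ F) (hf : Represents F z₀ f μ) :
    CommutatorBound.{u} F f (mNorm F μ).toNNReal := by
  intro H _ _ _ N R hN hσ
  have hcont : ContinuousOn f (spectrum ℂ N) := (hf.continuousOn hF hμ hz₀).mono hσ
  obtain ⟨c, hc⟩ := hf
  let φ : C(spectrum ℂ N, ℂ) := ⟨(spectrum ℂ N).domRestrict f, hcont.domRestrict⟩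
  -- The limit of the truncations is `f - c`; the constant disappears in the commutator.
  have hφ : Tendsto (fun K => cfcCommutator hN R (compactCauchy hσ μ z₀ K)) atTop
      (𝓝 (cfcCommutator hN R (φ - algebraMap ℂ _ c))) :=
    ((cfcCommutator hN R).continuous.tendsto _).comp <| tendsto_compactCauchy hσ hF hμ hz₀
      fun z => sub_eq_of_eq_add' (hc z (hσ z.2))
  rw [map_sub, cfcCommutator_algebraMap, sub_zero] at hφ
  rw [cfc_apply f N hN hcont]
  exact le_of_tendsto hφ.norm <| .of_forall fun K =>
    norm_cfcCommutator_compactCauchy_le hN hσ hμ hz₀ K R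

end CauchyCL

theorem mainTheorem10 (F : Set ℂ) (hF : IsClosed F) (hne : F.Nonempty) (hproper : F ≠ Set.univ)
    (z₀ : ℂ) (hz₀ : z₀ ∈ F) :
    CauchyCL.mHat F z₀ ⊆ CauchyCL.CL.{u} F ∧
      ∀ f ∈ CauchyCL.mHat F z₀, CauchyCL.clNorm.{u} F f ≤ CauchyCL.mHatNorm F z₀ f := by
  refine ⟨fun f ⟨μ, hμ, hf⟩ => ⟨hf.continuousOn hF hμ hz₀, _, hf.commutatorBound hF hμ hz₀⟩,
    fun f _ => le_iInf₂ fun μ hμ => ?_⟩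
  obtain ⟨hμ, hf⟩ := hμ
  rw [← ENNReal.coe_toNNReal hμ.ne]
  exact iInf₂_le (CauchyCL.mNorm F μ).toNNReal ⟨hf.continuousOn hF hμ hz₀, hf.commutatorBound hF hμ hz₀⟩
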